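/- For every positive integer $N$ and every real number $\tau$ let $$\mathfrak{m}_N(\tau) := \min\left\{\left|\sum_{n=1}^N \frac{s_n}{n} - \tau\right| : s_1,\dots,s_N\in\{-1,+1\}\right\}$$ be the distance from $\tau$ to the nearest signed harmonic sum of length $N$. Then for every $\tau\in\mathbb{R}$ and every real constant $C$ with $0<C<1/\log 4$ there exists $N_0$, depending only on $C$ and $\tau$, such that $$\mathfrak{m}_N(\tau) < \exp\left(-C(\log N)^2\right)$$ for all integers $N\ge N_0$. -/

import Mathlib

/-- The set of all signed harmonic sums `∑_{n=1}^N s_n / n` with signs `s_n ∈ {-1, +1}`. -/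
def signedHarmonicSums (N : ℕ) : Set ℝ :=
  {x | ∃ s : ℕ → ℝ, (∀ n ∈ Finset.Icc 1 N, s n = -1 ∨ s n = 1) ∧
    x = ∑ n ∈ Finset.Icc 1 N, s n / (n : ℝ)}

/-- The minimum of `|x - τ|` over all signed harmonic sums `x` of length `N`. The lemma
`isLeast_minSignedHarmonicDist` shows that this infimum is attained. -/
noncomputable def minSignedHarmonicDist (N : ℕ) (τ : ℝ) : ℝ :=
  sInf ((fun x : ℝ => |x - τ|) '' signedHarmonicSums N)

theorem signedHarmonicSums_nonempty (N : ℕ) : (signedHarmonicSums N).Nonempty :=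
  ⟨_, fun _ => 1, fun _ _ => Or.inr rfl, rfl⟩

theorem signedHarmonicSums_finite (N : ℕ) : (signedHarmonicSums N).Finite := by
  induction N with
  | zero =>
    refine (Set.finite_singleton (0 : ℝ)).subset ?_
    rintro x ⟨s, -, rfl⟩
    simp
  | succ N ih =>
    refine ((ih.image fun x => x + (-1) / ((N + 1 : ℕ) : ℝ)).union
      (ih.image fun x => x + 1 / ((N + 1 : ℕ) : ℝ))).subset ?_
    rintro x ⟨s, hs, rfl⟩
    have hmem : (∑ n ∈ Finset.Icc 1 N, s n / (n : ℝ)) ∈ signedHarmonicSums N :=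
      ⟨s, fun n hn => hs n (by simp only [Finset.mem_Icc] at hn ⊢; omega), rfl⟩
    rw [Finset.sum_Icc_succ_top (by omega)]
    rcases hs (N + 1) (by simp) with h | h
    · exact Or.inl ⟨_, hmem, by rw [h]⟩
    · exact Or.inr ⟨_, hmem, by rw [h]⟩

/-- The infimum in the definition of `minSignedHarmonicDist` is a minimum. -/
theorem isLeast_minSignedHarmonicDist (N : ℕ) (τ : ℝ) :
    IsLeast ((fun x : ℝ => |x - τ|) '' signedHarmonicSums N) (minSignedHarmonicDist N τ) :=
  have hf := (signedHarmonicSums_finite N).image fun x : ℝ => |x - τ|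
  have hn := (signedHarmonicSums_nonempty N).image fun x : ℝ => |x - τ|
  ⟨hn.csInf_mem hf, fun _ hy => csInf_le hf.bddBelow hy⟩

/-! Greedy signs on `1, …, M` come within `1 / M` of `τ`, by divergence of the harmonic series. The
terms from `M + 1` to `N` then shrink the error in `K` stages.

Stage `k` uses progressions of `2 ^ k` terms and step `m` with Thue–Morse signs: their sum is a
`k`-fold difference of `1 / x`, with steps `m 2^i`. As a Laplace transform it lies between `stepProd
m k * k! / N ^ (k + 1)` and the same with `M` (`le_blockSum`, `blockSum_le`). By `Lowers`, each such
sum, with a suitable global sign, removes at least the lower bound until the error is at most the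
upper one. A stage has enough progressions to absorb the previous error when `2 ^ K * m ^ 2 ≥ 4 N`
and `N ^ K ≤ 2 M ^ K` (`exists_signedSums_stage`).

With `L = log N`, `m` about `N ^ ε` and `2 ^ K` about `N ^ (1 - 2 ε)`, the final error has logarithm
about `K ^ 2 / 2 * log 2 - K * L`, which tends to `-L ^ 2 / log 4` to leading order as `ε → 0`. -/

/-! ### Signed sums and error reduction. -/

/-- The values `∑_{n ∈ A} s_n / n` over all choices of signs `s_n ∈ {-1, +1}`. -/
def signedSums (A : Finset ℕ) : Set ℝ :=
  {v | ∃ s : ℕ → ℝ, (∀ n ∈ A, s n = -1 ∨ s n = 1) ∧ v = ∑ n ∈ A, s n / (n : ℝ)}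

theorem neg_mem_signedSums {A : Finset ℕ} {v : ℝ} (hv : v ∈ signedSums A) :
    -v ∈ signedSums A := by
  obtain ⟨s, hs, rfl⟩ := hv
  refine ⟨fun n => -s n, fun n hn => ?_, ?_⟩
  · rcases hs n hn with h | h <;> simp [h]
  · simp [neg_div]

theorem add_mem_signedSums {A B : Finset ℕ} (hAB : Disjoint A B) {v w : ℝ}
    (hv : v ∈ signedSums A) (hw : w ∈ signedSums B) : v + w ∈ signedSums (A ∪ B) := by
  obtain ⟨s, hs, rfl⟩ := hv
  obtain ⟨t, ht, rfl⟩ := hw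
  have hB : ∀ n ∈ B, n ∉ A := fun n hn hn' => Finset.disjoint_left.1 hAB hn' hn
  refine ⟨fun n => if n ∈ A then s n else t n, fun n hn => ?_, ?_⟩
  · by_cases h : n ∈ A
    · simpa [h] using hs n h
    · simpa [h] using ht n ((Finset.mem_union.1 hn).resolve_left h)
  · rw [Finset.sum_union hAB]
    congr 1
    · exact Finset.sum_congr rfl fun n hn => by simp [hn]
    · exact Finset.sum_congr rfl fun n hn => by simp [hB n hn]

theorem zero_mem_signedSums_empty : (0 : ℝ) ∈ signedSums ∅ := ⟨fun _ => 1, by simp, by simp⟩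

/-- Signed sums over `A` can reduce any error of size at most `c + lo` to size at most `c`,
as long as `c` is at least `hi`. -/
def Lowers (A : Finset ℕ) (hi lo : ℝ) : Prop :=
  ∀ c, hi ≤ c → ∀ r : ℝ, |r| ≤ c + lo → ∃ v ∈ signedSums A, |r - v| ≤ c

/-- Give `v` the sign of `r`: an overshoot is at most `hi ≤ c`, and otherwise at least `lo` is
gained. -/
theorem Lowers.of_mem {A : Finset ℕ} {hi lo v : ℝ} (hv : v ∈ signedSums A)
    (hlo : lo ≤ v) (hhi : v ≤ hi) : Lowers A hi lo := by
  intro c hc r hr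
  rw [abs_le] at hr
  rcases le_total 0 r with h | h
  · exact ⟨v, hv, abs_le.2 ⟨by linarith, by linarith⟩⟩
  · exact ⟨-v, neg_mem_signedSums hv, abs_le.2 ⟨by linarith, by linarith⟩⟩

theorem lowers_empty (hi : ℝ) : Lowers ∅ hi 0 := fun c _ r hr =>
  ⟨0, zero_mem_signedSums_empty, by simpa using hr⟩

theorem Lowers.union {A B : Finset ℕ} {hi a b : ℝ} (hA : Lowers A hi a) (hB : Lowers B hi b)
    (hAB : Disjoint A B) (hb : 0 ≤ b) : Lowers (A ∪ B) hi (a + b) := by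
  intro c hc r hr
  -- Quantifying over all `c ≥ hi` lets `A` aim at the larger target `c + b`.
  obtain ⟨v, hv, hvr⟩ := hA (c + b) (by linarith) r (by linarith)
  obtain ⟨w, hw, hwr⟩ := hB c hc (r - v) hvr
  exact ⟨v + w, add_mem_signedSums hAB hv hw, by rwa [← sub_sub]⟩

theorem Lowers.biUnion {A : ℕ → Finset ℕ} {hi lo : ℝ} (hlo : 0 ≤ lo) (n : ℕ)
    (hA : ∀ i < n, Lowers (A i) hi lo) (hd : ∀ i j, j < n → i < j → Disjoint (A i) (A j)) :
    Lowers ((Finset.range n).biUnion A) hi (n * lo) := by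
  induction n with
  | zero => simpa using lowers_empty hi
  | succ n ih =>
    have h := (ih (fun i hi => hA i (by omega)) (fun i j hj => hd i j (by omega))).union
      (hA n (by omega)) ((Finset.disjoint_biUnion_left _ _ _).2 fun i hi =>
        hd i n (by omega) (Finset.mem_range.1 hi)) hlo
    rw [Finset.range_add_one, Finset.biUnion_insert, Finset.union_comm]
    convert h using 1
    push_cast
    ring

theorem Lowers.exists_mem_union {A B : Finset ℕ} {hi lo τ v : ℝ} (hB : Lowers B hi lo)
    (hAB : Disjoint A B) (hv : v ∈ signedSums A) {c : ℝ} (hc : hi ≤ c) (h : |τ - v| ≤ c + lo) :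
    ∃ w ∈ signedSums (A ∪ B), |τ - w| ≤ c := by
  obtain ⟨w, hw, hwr⟩ := hB c hc (τ - v) h
  exact ⟨v + w, add_mem_signedSums hAB hv hw, by rwa [← sub_sub]⟩

/-! ### Greedy approximation. -/

theorem one_div_mem_signedSums_singleton (n : ℕ) : 1 / (n : ℝ) ∈ signedSums {n} :=
  ⟨fun _ => 1, by simp, by simp⟩

/-- Each term moves towards `τ`. A large error drops by the full term; an error at most `1 / n`
passes to one at most `1 / (n + 1)` because `1 / n ≤ 2 / (n + 1)`. -/
theorem exists_signedSums_le_max (τ : ℝ) (n : ℕ) :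
    ∃ v ∈ signedSums (Finset.Ico 1 (n + 1)),
      |τ - v| ≤ max (1 / (n : ℝ)) (|τ| - ∑ i ∈ Finset.range n, 1 / ((i : ℝ) + 1)) := by
  induction n with
  | zero => exact ⟨0, by simpa using zero_mem_signedSums_empty, by simp⟩
  | succ n ih =>
    obtain ⟨v, hv, hvτ⟩ := ih
    have hL : Lowers {n + 1} (1 / ((n + 1 : ℕ) : ℝ)) (1 / ((n + 1 : ℕ) : ℝ)) :=
      .of_mem (one_div_mem_signedSums_singleton _) le_rfl le_rfl
    have hU : Finset.Ico 1 (n + 1 + 1) = Finset.Ico 1 (n + 1) ∪ {n + 1} := by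
      ext j
      simp only [Finset.mem_union, Finset.mem_Ico, Finset.mem_singleton]
      omega
    rw [hU]
    refine hL.exists_mem_union (by simp) hv (le_max_left _ _) (hvτ.trans ?_)
    rw [Finset.sum_range_succ]
    refine max_le ?_ ?_
    · have h2 : 1 / (n : ℝ) ≤ 1 / ((n + 1 : ℕ) : ℝ) + 1 / ((n + 1 : ℕ) : ℝ) := by
        rcases Nat.eq_zero_or_pos n with rfl | hn
        · norm_num
        · have : (1 : ℝ) ≤ n := by exact_mod_cast hn
          rw [← add_div, div_le_div_iff₀ (by positivity) (by positivity)]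
          push_cast
          linarith
      exact h2.trans (by gcongr; exact le_max_left _ _)
    · have := le_max_right (1 / ((n + 1 : ℕ) : ℝ))
        (|τ| - (∑ i ∈ Finset.range n, 1 / ((i : ℝ) + 1) + 1 / ((n : ℝ) + 1)))
      push_cast at this ⊢
      linarith

theorem eventually_exists_signedSums_le (τ : ℝ) :
    ∃ n₀ : ℕ, ∀ n ≥ n₀, ∃ v ∈ signedSums (Finset.Ico 1 (n + 1)), |τ - v| ≤ 1 / (n : ℝ) := by
  obtain ⟨n₀, h⟩ := Filter.eventually_atTop.1
    (Real.tendsto_sum_range_one_div_nat_succ_atTop.eventually_ge_atTop |τ|)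
  refine ⟨n₀, fun n hn => ?_⟩
  obtain ⟨v, hv, hvτ⟩ := exists_signedSums_le_max τ n
  refine ⟨v, hv, hvτ.trans (max_le le_rfl ?_)⟩
  exact (sub_nonpos.2 (h n hn)).trans (by positivity)

/-! ### Iterated differences of `1 / x` as Laplace transforms. -/

theorem integral_pow_mul_exp_neg_mul (k : ℕ) {a : ℝ} (ha : 0 < a) :
    ∫ t in Set.Ioi (0 : ℝ), t ^ k * Real.exp (-(a * t)) = k.factorial / a ^ (k + 1) := by
  have h := Real.integral_rpow_mul_exp_neg_mul_Ioi (a := (k : ℝ) + 1) (r := a) (by positivity) ha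
  rw [Real.Gamma_nat_eq_factorial] at h
  simp only [add_sub_cancel_right, Real.rpow_natCast] at h
  rw [h, show (k : ℝ) + 1 = ((k + 1 : ℕ) : ℝ) by push_cast; rfl, Real.rpow_natCast, one_div,
    inv_pow, inv_mul_eq_div]

theorem integrableOn_pow_mul_exp_neg_mul (k : ℕ) {a : ℝ} (ha : 0 < a) :
    MeasureTheory.IntegrableOn (fun t : ℝ => t ^ k * Real.exp (-(a * t))) (Set.Ioi 0) := by
  -- A non-integrable function has integral `0` by convention, but this one is positive.
  by_contra h
  have h0 := MeasureTheory.integral_undef h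
  rw [integral_pow_mul_exp_neg_mul k ha] at h0
  have : (0 : ℝ) < k.factorial / a ^ (k + 1) := by positivity
  exact this.ne' h0

/-- The product `∏_{i < k} (1 - exp (-m 2^i t))`. -/
noncomputable def expWeight (m k : ℕ) (t : ℝ) : ℝ :=
  ∏ i ∈ Finset.range k, (1 - Real.exp (-((m : ℝ) * 2 ^ i * t)))

/-- The product `∏_{i < k} m 2^i` of the steps of a block. -/
def stepProd (m k : ℕ) : ℝ := ∏ i ∈ Finset.range k, ((m : ℝ) * 2 ^ i)

theorem expWeight_nonneg (m k : ℕ) {t : ℝ} (ht : 0 ≤ t) : 0 ≤ expWeight m k t :=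
  Finset.prod_nonneg fun i _ => by
    have : 0 ≤ (m : ℝ) * 2 ^ i * t := by positivity
    simpa using this

theorem expWeight_le (m k : ℕ) {t : ℝ} (ht : 0 ≤ t) :
    expWeight m k t ≤ stepProd m k * t ^ k := by
  have h : stepProd m k * t ^ k = ∏ i ∈ Finset.range k, ((m : ℝ) * 2 ^ i * t) := by
    rw [Finset.prod_mul_distrib, Finset.prod_const, Finset.card_range]; rfl
  rw [h]
  refine Finset.prod_le_prod (fun i _ => ?_) fun i _ => ?_
  · have : 0 ≤ (m : ℝ) * 2 ^ i * t := by positivity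
    simpa using this
  · linarith [Real.add_one_le_exp (-((m : ℝ) * 2 ^ i * t))]

/-- Each factor satisfies `1 - e⁻ᵘ ≥ u e⁻ᵘ`, and the steps `m 2^i` add up to `m (2 ^ k - 1)`. -/
theorem le_expWeight (m k : ℕ) {t : ℝ} (ht : 0 ≤ t) :
    stepProd m k * t ^ k * Real.exp (-((m * (2 ^ k - 1) : ℝ) * t)) ≤ expWeight m k t := by
  induction k with
  | zero => simp [stepProd, expWeight]
  | succ k ih =>
    set u : ℝ := (m : ℝ) * 2 ^ k * t with hu
    have hu0 : 0 ≤ u := by positivity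
    have h1 : u * Real.exp (-u) ≤ 1 - Real.exp (-u) := by
      have := mul_le_mul_of_nonneg_right (Real.add_one_le_exp u) (Real.exp_pos (-u)).le
      rw [← Real.exp_add, add_neg_cancel, Real.exp_zero] at this
      linarith
    have h2 : expWeight m (k + 1) t = expWeight m k t * (1 - Real.exp (-u)) :=
      Finset.prod_range_succ _ _
    have h3 : stepProd m (k + 1) = stepProd m k * (m * 2 ^ k) := Finset.prod_range_succ _ _
    have h4 : Real.exp (-((m * (2 ^ (k + 1) - 1) : ℝ) * t))
        = Real.exp (-((m * (2 ^ k - 1) : ℝ) * t)) * Real.exp (-u) := by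
      rw [← Real.exp_add]; congr 1; rw [hu]; ring
    rw [h2, h3, h4]
    refine le_trans (le_of_eq ?_) (mul_le_mul ih h1 (by positivity) (expWeight_nonneg m k ht))
    generalize Real.exp (-u) = e
    rw [hu]; ring

theorem stepProd_nonneg (m k : ℕ) : 0 ≤ stepProd m k :=
  Finset.prod_nonneg fun i _ => by positivity

/-- The Thue–Morse signed sum of `1 / n` over `{a + m j : j < 2 ^ k}`, as a Laplace transform. -/
noncomputable def blockSum (m k : ℕ) (a : ℝ) : ℝ :=
  ∫ t in Set.Ioi (0 : ℝ), Real.exp (-(a * t)) * expWeight m k t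

theorem integrableOn_blockSum (m k : ℕ) {a : ℝ} (ha : 0 < a) :
    MeasureTheory.IntegrableOn (fun t : ℝ => Real.exp (-(a * t)) * expWeight m k t)
      (Set.Ioi 0) := by
  refine ((integrableOn_pow_mul_exp_neg_mul k ha).const_mul (stepProd m k)).mono' ?_ ?_
  · refine Continuous.aestronglyMeasurable ?_
    unfold expWeight
    fun_prop
  · refine (MeasureTheory.ae_restrict_mem measurableSet_Ioi).mono fun t ht => ?_
    have ht : (0 : ℝ) < t := ht
    rw [Real.norm_of_nonneg (mul_nonneg (Real.exp_pos _).le (expWeight_nonneg m k ht.le))]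
    have := mul_le_mul_of_nonneg_left (expWeight_le m k ht.le) (Real.exp_pos (-(a * t))).le
    linarith

theorem blockSum_zero (m : ℕ) {a : ℝ} (ha : 0 < a) : blockSum m 0 a = 1 / a := by
  simpa [blockSum, expWeight] using integral_pow_mul_exp_neg_mul 0 ha

theorem blockSum_succ (m k : ℕ) {a : ℝ} (ha : 0 < a) :
    blockSum m (k + 1) a = blockSum m k a - blockSum m k (a + m * 2 ^ k) := by
  have ha' : 0 < a + m * 2 ^ k := by positivity
  unfold blockSum
  rw [← MeasureTheory.integral_sub (integrableOn_blockSum m k ha) (integrableOn_blockSum m k ha')]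
  congr 1
  ext t
  have h : Real.exp (-((a + m * 2 ^ k) * t))
      = Real.exp (-(a * t)) * Real.exp (-((m : ℝ) * 2 ^ k * t)) := by
    rw [← Real.exp_add]; congr 1; ring
  rw [h, expWeight, Finset.prod_range_succ, ← expWeight]
  ring

theorem blockSum_le (m k : ℕ) {a : ℝ} (ha : 0 < a) :
    blockSum m k a ≤ stepProd m k * k.factorial / a ^ (k + 1) := by
  rw [mul_div_assoc, ← integral_pow_mul_exp_neg_mul k ha, ← MeasureTheory.integral_const_mul]
  refine MeasureTheory.setIntegral_mono_on (integrableOn_blockSum m k ha)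
    ((integrableOn_pow_mul_exp_neg_mul k ha).const_mul _) measurableSet_Ioi fun t ht => ?_
  have ht : (0 : ℝ) < t := ht
  have := mul_le_mul_of_nonneg_left (expWeight_le m k ht.le) (Real.exp_pos (-(a * t))).le
  linarith

theorem le_blockSum (m k : ℕ) {a : ℝ} (ha : 0 < a) :
    stepProd m k * k.factorial / (a + m * (2 ^ k - 1)) ^ (k + 1) ≤ blockSum m k a := by
  have ha' : 0 < a + m * (2 ^ k - 1) := by
    have : (1 : ℝ) ≤ 2 ^ k := one_le_pow₀ one_le_two
    have : 0 ≤ (m : ℝ) * (2 ^ k - 1) := mul_nonneg (by positivity) (by linarith)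
    linarith
  rw [mul_div_assoc, ← integral_pow_mul_exp_neg_mul k ha', ← MeasureTheory.integral_const_mul]
  refine MeasureTheory.setIntegral_mono_on
    ((integrableOn_pow_mul_exp_neg_mul k ha').const_mul _) (integrableOn_blockSum m k ha)
    measurableSet_Ioi fun t ht => ?_
  have ht : (0 : ℝ) < t := ht
  have h : Real.exp (-((a + m * (2 ^ k - 1)) * t))
      = Real.exp (-(a * t)) * Real.exp (-((m * (2 ^ k - 1) : ℝ) * t)) := by
    rw [← Real.exp_add]; congr 1; ring
  have := mul_le_mul_of_nonneg_left (le_expWeight m k ht.le) (Real.exp_pos (-(a * t))).le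
  rw [h]
  linarith

/-! ### Progressions and the intervals they tile. -/

/-- The arithmetic progression `{a + m j : j < 2 ^ k}`. -/
def block (m k a : ℕ) : Finset ℕ := (Finset.range (2 ^ k)).image fun j => a + m * j

theorem block_succ (m k a : ℕ) : block m (k + 1) a = block m k a ∪ block m k (a + m * 2 ^ k) := by
  ext n
  simp only [block, Finset.mem_union, Finset.mem_image, Finset.mem_range]
  constructor
  · rintro ⟨j, hj, rfl⟩
    rcases lt_or_ge j (2 ^ k) with h | h
    · exact Or.inl ⟨j, h, rfl⟩
    · obtain ⟨i, rfl⟩ := Nat.exists_eq_add_of_le h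
      exact Or.inr ⟨i, by rw [pow_succ] at hj; omega, by ring⟩
  · rintro (⟨j, hj, rfl⟩ | ⟨j, hj, rfl⟩)
    · exact ⟨j, by rw [pow_succ]; omega, rfl⟩
    · exact ⟨2 ^ k + j, by rw [pow_succ]; omega, by ring⟩

theorem disjoint_block_add {m : ℕ} (hm : 0 < m) (k a : ℕ) :
    Disjoint (block m k a) (block m k (a + m * 2 ^ k)) := by
  rw [Finset.disjoint_left]
  simp only [block, Finset.mem_image, Finset.mem_range]
  rintro n ⟨j, hj, rfl⟩ ⟨i, hi, h⟩
  have h' : m * (2 ^ k + i) = m * j := by rw [mul_add]; omega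
  have := Nat.eq_of_mul_eq_mul_left hm h'
  omega

theorem blockSum_mem_signedSums {m : ℕ} (hm : 0 < m) (k : ℕ) :
    ∀ a : ℕ, 0 < a → blockSum m k a ∈ signedSums (block m k a) := by
  induction k with
  | zero =>
    intro a ha
    rw [blockSum_zero m (by exact_mod_cast ha)]
    simpa [block] using one_div_mem_signedSums_singleton a
  | succ k ih =>
    intro a ha
    have h := add_mem_signedSums (disjoint_block_add hm k a) (ih a ha)
      (neg_mem_signedSums (ih (a + m * 2 ^ k) (by omega)))
    rw [block_succ, blockSum_succ m k (by exact_mod_cast ha), sub_eq_add_neg]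
    simpa using h

theorem disjoint_block_of_lt {m k a i j : ℕ} (hij : i < j) (hj : j < m) :
    Disjoint (block m k (a + i)) (block m k (a + j)) := by
  rw [Finset.disjoint_left]
  simp only [block, Finset.mem_image, Finset.mem_range]
  rintro n ⟨p, -, rfl⟩ ⟨q, -, h⟩
  have h' : (j + m * q) % m = (i + m * p) % m := by congr 1; omega
  rw [Nat.add_mul_mod_self_left, Nat.add_mul_mod_self_left, Nat.mod_eq_of_lt hj,
    Nat.mod_eq_of_lt (hij.trans hj)] at h'
  omega

theorem biUnion_block {m : ℕ} (hm : 0 < m) (k a : ℕ) :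
    (Finset.range m).biUnion (fun r => block m k (a + r)) = Finset.Ico a (a + m * 2 ^ k) := by
  ext n
  simp only [block, Finset.mem_biUnion, Finset.mem_image, Finset.mem_range, Finset.mem_Ico]
  constructor
  · rintro ⟨r, hr, j, hj, rfl⟩
    have : m * (j + 1) ≤ m * 2 ^ k := Nat.mul_le_mul_left _ hj
    rw [mul_add] at this
    omega
  · rintro ⟨h1, h2⟩
    refine ⟨(n - a) % m, Nat.mod_lt _ hm, (n - a) / m, ?_, ?_⟩
    · rw [Nat.div_lt_iff_lt_mul hm, mul_comm]; omega
    · have := Nat.mod_add_div (n - a) m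
      omega

/-- The bounds depend on the block only through `M` and `N`, so all blocks in the range can be
combined. -/
theorem lowers_block {m k a M N : ℕ} (hm : 0 < m) (hM : 0 < M) (ha : M ≤ a)
    (hN : a + m * (2 ^ k - 1) ≤ N) :
    Lowers (block m k a) (stepProd m k * k.factorial / (M : ℝ) ^ (k + 1))
      (stepProd m k * k.factorial / (N : ℝ) ^ (k + 1)) := by
  have hMr : (0 : ℝ) < M := by exact_mod_cast hM
  have hMa : (M : ℝ) ≤ a := by exact_mod_cast ha
  have har : (0 : ℝ) < a := hMr.trans_le hMa
  have hNr : (a : ℝ) + m * (2 ^ k - 1) ≤ N := by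
    have : ((a + m * (2 ^ k - 1) : ℕ) : ℝ) ≤ N := by exact_mod_cast hN
    rwa [Nat.cast_add, Nat.cast_mul, Nat.cast_sub Nat.one_le_two_pow, Nat.cast_pow,
      Nat.cast_ofNat, Nat.cast_one] at this
  have h1 : (1 : ℝ) ≤ 2 ^ k := one_le_pow₀ one_le_two
  have h2 : 0 ≤ (m : ℝ) * (2 ^ k - 1) := mul_nonneg (by positivity) (by linarith)
  have h3 := stepProd_nonneg m k
  refine .of_mem (blockSum_mem_signedSums hm k a (hM.trans_le ha)) ?_ ?_
  · refine le_trans ?_ (le_blockSum m k har)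
    gcongr
  · refine (blockSum_le m k har).trans ?_
    gcongr

theorem lowers_Ico {m k a M N : ℕ} (hm : 0 < m) (hM : 0 < M) (ha : M ≤ a) (q : ℕ)
    (hN : a + q * (m * 2 ^ k) ≤ N + 1) :
    Lowers (Finset.Ico a (a + q * (m * 2 ^ k))) (stepProd m k * k.factorial / (M : ℝ) ^ (k + 1))
      (q * (m * (stepProd m k * k.factorial / (N : ℝ) ^ (k + 1)))) := by
  have hlo : 0 ≤ stepProd m k * k.factorial / (N : ℝ) ^ (k + 1) := by
    have := stepProd_nonneg m k
    positivity
  induction q with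
  | zero => simpa using lowers_empty _
  | succ q ih =>
    rw [add_mul, one_mul, ← add_assoc] at hN ⊢
    have hpos : m * 2 ^ k = m * (2 ^ k - 1) + m := by
      rw [← Nat.mul_succ, Nat.succ_eq_add_one, Nat.sub_add_cancel Nat.one_le_two_pow]
    have hB := Lowers.biUnion (A := fun r => block m k (a + q * (m * 2 ^ k) + r)) hlo m
      (fun r hr => lowers_block hm hM (by omega) (by omega))
      (fun i j hj hij => disjoint_block_of_lt hij hj)
    rw [biUnion_block hm] at hB
    have h := (ih (by omega)).union hB (Finset.Ico_disjoint_Ico_consecutive _ _ _) (by positivity)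
    rw [Finset.Ico_union_Ico_eq_Ico (by omega) (by omega)] at h
    convert h using 1
    push_cast
    ring

/-! ### Induction over the stages. -/

theorem exists_signedSums_stage {K m M N : ℕ} {τ : ℝ} (hm : 0 < m) (hM : 0 < M)
    (hN : M + K * (m * 2 ^ K) = N) (hMN : (N : ℝ) ^ K ≤ 2 * (M : ℝ) ^ K)
    (hmN : 4 * (N : ℝ) ≤ 2 ^ K * (m : ℝ) ^ 2)
    (h₀ : ∃ v ∈ signedSums (Finset.Ico 1 (M + 1)), |τ - v| ≤ 1 / (M : ℝ)) (k : ℕ) (hk : k ≤ K) :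
    ∃ v ∈ signedSums (Finset.Ico 1 (M + 1 + k * (m * 2 ^ K))),
      |τ - v| ≤ stepProd m k * k.factorial / (M : ℝ) ^ (k + 1) := by
  induction k with
  | zero => simpa [stepProd] using h₀
  | succ k ih =>
    obtain ⟨v, hv, hvτ⟩ := ih (by omega)
    have hMr : (0 : ℝ) < M := by exact_mod_cast hM
    have hNM : M ≤ N := by omega
    have hNMr : (M : ℝ) ≤ N := by exact_mod_cast hNM
    have hNr : (0 : ℝ) < N := hMr.trans_le hNMr
    -- All stages have the same length; stage `k + 1` splits into `2 ^ (K - (k + 1))` intervals,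
    -- each tiled by `m` progressions.
    have hlen : 2 ^ (K - (k + 1)) * (m * 2 ^ (k + 1)) = m * 2 ^ K := by
      rw [mul_left_comm, ← pow_add, Nat.sub_add_cancel hk]
    have hkK : (k + 1) * (m * 2 ^ K) ≤ K * (m * 2 ^ K) := Nat.mul_le_mul_right _ hk
    have hL := lowers_Ico (k := k + 1) (a := M + 1 + k * (m * 2 ^ K)) (N := N) hm hM (by omega)
      (2 ^ (K - (k + 1))) (by rw [hlen]; rw [add_mul] at hkK; omega)
    rw [hlen] at hL
    have hU : M + 1 + (k + 1) * (m * 2 ^ K) = M + 1 + k * (m * 2 ^ K) + m * 2 ^ K := by ring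
    rw [hU, ← Finset.Ico_union_Ico_eq_Ico (b := M + 1 + k * (m * 2 ^ K)) (by omega) (by omega)]
    refine hL.exists_mem_union (Finset.Ico_disjoint_Ico_consecutive _ _ _) hv le_rfl
      (hvτ.trans (le_add_of_nonneg_of_le ?_ ?_))
    · have := stepProd_nonneg m (k + 1)
      positivity
    have hratio : (N : ℝ) ^ (k + 1) ≤ 2 * (M : ℝ) ^ (k + 1) := by
      have h1 : ((N : ℝ) / M) ^ (k + 1) ≤ ((N : ℝ) / M) ^ K :=
        pow_le_pow_right₀ ((one_le_div hMr).2 hNMr) hk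
      have h2 : ((N : ℝ) / M) ^ K ≤ 2 := by
        rw [div_pow, div_le_iff₀ (by positivity)]; exact hMN
      rw [← div_le_iff₀ (by positivity), ← div_pow]
      exact h1.trans h2
    have hstep : stepProd m (k + 1) = stepProd m k * (m * 2 ^ k) := Finset.prod_range_succ _ _
    have hpow : (2 : ℝ) ^ (K - (k + 1)) * 2 ^ k * 2 = 2 ^ K := by
      rw [mul_assoc, ← pow_succ, ← pow_add, Nat.sub_add_cancel hk]
    have hkey : (N : ℝ) ^ (k + 2)
        ≤ 2 ^ (K - (k + 1)) * m * (m * 2 ^ k) * (k + 1) * (M : ℝ) ^ (k + 1) := by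
      calc (N : ℝ) ^ (k + 2) = N ^ (k + 1) * N := pow_succ _ _
        _ ≤ (2 * (M : ℝ) ^ (k + 1)) * (2 ^ K * (m : ℝ) ^ 2 / 4) := by
          gcongr
          linarith
        _ = 2 ^ (K - (k + 1)) * m * (m * 2 ^ k) * 1 * (M : ℝ) ^ (k + 1) := by
          rw [← hpow]; ring
        _ ≤ _ := by
          gcongr
          linarith [Nat.cast_nonneg (α := ℝ) k]
    rw [hstep, Nat.factorial_succ, div_le_iff₀ (by positivity)]
    push_cast
    have h3 := stepProd_nonneg m k
    calc stepProd m k * k.factorial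
        = stepProd m k * k.factorial * ((N : ℝ) ^ (k + 2) / N ^ (k + 2)) := by
          rw [div_self (by positivity), mul_one]
      _ ≤ stepProd m k * k.factorial * ((2 ^ (K - (k + 1)) * m * (m * 2 ^ k) * (k + 1)
            * (M : ℝ) ^ (k + 1)) / N ^ (k + 2)) := by gcongr
      _ = _ := by ring

/-! ### Choice of parameters and asymptotics. -/

theorem stepProd_le_exp {m : ℕ} {a : ℝ} (hm : (m : ℝ) ≤ Real.exp a) (k : ℕ) :
    stepProd m k ≤ Real.exp (k * a + (k : ℝ) ^ 2 / 2 * Real.log 2) := by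
  induction k with
  | zero => simp [stepProd]
  | succ k ih =>
    have h2 : (2 : ℝ) ^ k = Real.exp (k * Real.log 2) := by
      rw [Real.exp_nat_mul, Real.exp_log two_pos]
    have hs : stepProd m (k + 1) = stepProd m k * (m * 2 ^ k) := Finset.prod_range_succ _ _
    have hlog := Real.log_pos one_lt_two
    calc stepProd m (k + 1) = stepProd m k * (m * Real.exp (k * Real.log 2)) := by rw [hs, h2]
      _ ≤ Real.exp (k * a + (k : ℝ) ^ 2 / 2 * Real.log 2)
            * (Real.exp a * Real.exp (k * Real.log 2)) := by gcongr
      _ = Real.exp (k * a + (k : ℝ) ^ 2 / 2 * Real.log 2 + (a + k * Real.log 2)) := by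
        rw [← Real.exp_add, ← Real.exp_add]
      _ ≤ _ := by
        refine Real.exp_le_exp.2 ?_
        push_cast
        nlinarith

theorem factorial_le_exp {k : ℕ} {b : ℝ} (hk : (k : ℝ) ≤ Real.exp b) :
    (k.factorial : ℝ) ≤ Real.exp (k * b) := by
  rw [Real.exp_nat_mul]
  calc (k.factorial : ℝ) ≤ (k : ℝ) ^ k := by exact_mod_cast Nat.factorial_le_pow k
    _ ≤ _ := by gcongr

/-- Bernoulli: `(1 - d / x) ^ K ≥ 1 - K d / x ≥ 1 / 2`. -/
theorem pow_le_two_mul_sub_pow {K : ℕ} {x d : ℝ} (hx : 0 < x) (hdx : d ≤ x)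
    (h : 2 * (K * d) ≤ x) : x ^ K ≤ 2 * (x - d) ^ K := by
  have h1 := one_add_mul_le_pow (a := -(d / x)) (by
    have : d / x ≤ 1 := (div_le_one hx).2 hdx
    linarith) K
  have h2 : (K : ℝ) * (d / x) ≤ 1 / 2 := by
    rw [← mul_div_assoc, div_le_iff₀ hx]; linarith
  have h3 : x - d = x * (1 + -(d / x)) := by field_simp; ring
  rw [h3, mul_pow]
  nlinarith [pow_pos hx K]

theorem exponent_lt {K L C ε : ℝ} (hK : 0 ≤ K) (hε : 0 < ε) (hε' : ε ≤ 1 / 8) (hL : 1 < L)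
    (hC : C + ε < (1 - 4 * ε) / Real.log 4) (hK1 : K * Real.log 2 ≤ (1 - 2 * ε) * L)
    (hK3 : (1 - 3 * ε) * L ≤ K * Real.log 2)
    (hlog : Real.log (2 * L) + Real.log 4 ≤ ε * L / 2) (hone : Real.log 2 ≤ ε * L) :
    K * (Real.log 4 + ε * L) + K ^ 2 / 2 * Real.log 2 + K * Real.log (2 * L)
      - (K * L - Real.log 2) < -C * L ^ 2 := by
  have hl2 : 0 < Real.log 2 := Real.log_pos one_lt_two
  have hl4 : Real.log 4 = 2 * Real.log 2 := by
    rw [show (4 : ℝ) = 2 ^ 2 by norm_num, Real.log_pow]; norm_num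
  have e1 := mul_le_mul_of_nonneg_left hK1 hK
  have e2 := mul_le_mul_of_nonneg_left hlog hK
  -- Here `K (1 - ε) L / 2` is what is left of `K L` after the other terms, and `(1 - 3ε)(1 - ε) ≥ 1
  -- - 4ε`.
  have e3 : (C + ε) * L ^ 2 ≤ K * ((1 - ε) * L / 2) := by
    calc (C + ε) * L ^ 2 ≤ (1 - 4 * ε) / Real.log 4 * L ^ 2 := by gcongr
      _ = (1 - 4 * ε) * L ^ 2 / 2 / Real.log 2 := by rw [hl4]; field_simp
      _ ≤ K * ((1 - ε) * L / 2) := by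
        rw [div_le_iff₀ hl2]
        have h := mul_le_mul_of_nonneg_right hK3
          (show 0 ≤ (1 - ε) * L / 2 from
            div_nonneg (mul_nonneg (by linarith) (by linarith)) zero_le_two)
        have h' := mul_nonneg (sq_nonneg ε) (sq_nonneg L)
        linarith
  have e4 : Real.log 2 < ε * L ^ 2 := by
    have := mul_lt_mul_of_pos_left hL (show 0 < ε * L by positivity)
    linarith
  linarith

theorem exists_signedSums_lt {τ C ε : ℝ} {n₀ N : ℕ} (hε : 0 < ε) (hε' : ε ≤ 1 / 8)
    (hC : C + ε < (1 - 4 * ε) / Real.log 4)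
    (hn₀ : ∀ n ≥ n₀, ∃ v ∈ signedSums (Finset.Ico 1 (n + 1)), |τ - v| ≤ 1 / (n : ℝ))
    (hN₀ : 2 * n₀ ≤ N) (hL2 : 2 ≤ Real.log N)
    (hsq : 32 * Real.log N ^ 2 ≤ Real.exp (ε * Real.log N))
    (hlog : Real.log (2 * Real.log N) + Real.log 4 ≤ ε * Real.log N / 2)
    (hone : Real.log 2 ≤ ε * Real.log N) :
    ∃ v ∈ signedSums (Finset.Ico 1 (N + 1)), |τ - v| < Real.exp (-C * Real.log N ^ 2) := by
  set L := Real.log N with hLdef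
  have hl2 : (1 / 2 : ℝ) < Real.log 2 := by linarith [Real.log_two_gt_d9]
  have hl2' : Real.log 2 < 1 := by linarith [Real.log_two_lt_d9]
  have hNpos : (0 : ℝ) < N := by
    rcases Nat.eq_zero_or_pos N with rfl | h
    · norm_num [hLdef] at hL2
    · exact_mod_cast h
  have hNexp : Real.exp L = N := Real.exp_log hNpos
  set K := ⌊(1 - 2 * ε) * L / Real.log 2⌋₊ with hKdef
  -- The floor in `K` may halve `2 ^ K`; the factor `3` still gives `9 / 2 ≥ 4` in `hmN`.
  set m := ⌈3 * Real.exp (ε * L)⌉₊ with hmdef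
  have hK1 : (K : ℝ) * Real.log 2 ≤ (1 - 2 * ε) * L := by
    rw [← le_div_iff₀ (by linarith)]
    exact Nat.floor_le (div_nonneg (mul_nonneg (by linarith) (by linarith)) (by linarith))
  have hK2 : (1 - 2 * ε) * L < (K + 1) * Real.log 2 := by
    rw [← div_lt_iff₀ (by linarith)]
    exact Nat.lt_floor_add_one _
  have hK3 : (1 - 3 * ε) * L ≤ K * Real.log 2 := by linarith
  have hK4 : (K : ℝ) ≤ 2 * L := by
    have : (0 : ℝ) ≤ K := K.cast_nonneg
    nlinarith
  have hK5 : (1 : ℝ) ≤ K := by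
    have h : (0 : ℝ) < K := by
      by_contra h
      nlinarith
    exact_mod_cast (Nat.cast_pos.1 h : 0 < K)
  have hexp1 : 1 ≤ Real.exp (ε * L) := Real.one_le_exp (by positivity)
  have hm1 : 3 * Real.exp (ε * L) ≤ m := Nat.le_ceil _
  have hm2 : (m : ℝ) ≤ 4 * Real.exp (ε * L) := by
    have : (m : ℝ) < 3 * Real.exp (ε * L) + 1 := Nat.ceil_lt_add_one (by positivity)
    linarith
  have hmpos : 0 < m := by
    have : (0 : ℝ) < m := by linarith
    exact_mod_cast this
  have h2K : (2 : ℝ) ^ K = Real.exp (K * Real.log 2) := by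
    rw [Real.exp_nat_mul, Real.exp_log two_pos]
  have h2K1 : (2 : ℝ) ^ K ≤ Real.exp ((1 - 2 * ε) * L) := by
    rw [h2K]; exact Real.exp_le_exp.2 hK1
  have h2K2 : Real.exp ((1 - 2 * ε) * L) ≤ 2 * 2 ^ K := by
    rw [h2K]
    nth_rewrite 2 [← Real.exp_log two_pos]
    rw [← Real.exp_add]
    exact Real.exp_le_exp.2 (by linarith)
  have hlen : 2 * (K * (K * (m * 2 ^ K : ℝ))) ≤ N := by
    calc 2 * (K * (K * (m * 2 ^ K : ℝ)))
        ≤ 2 * ((2 * L) * ((2 * L) * ((4 * Real.exp (ε * L)) * Real.exp ((1 - 2 * ε) * L)))) := by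
          gcongr
      _ = (32 * L ^ 2) * (Real.exp (ε * L) * Real.exp ((1 - 2 * ε) * L)) := by ring
      _ ≤ Real.exp (ε * L) * (Real.exp (ε * L) * Real.exp ((1 - 2 * ε) * L)) := by gcongr
      _ = N := by
        rw [← Real.exp_add, ← Real.exp_add, ← hNexp]
        congr 1
        ring
  -- Hence `M ≥ N / 2 ≥ n₀`, as the greedy start requires.
  have hhalf : 2 * (K * (m * 2 ^ K : ℝ)) ≤ N := by nlinarith
  have hhalfN : 2 * (K * (m * 2 ^ K)) ≤ N := by exact_mod_cast hhalf
  obtain ⟨M, hM⟩ : ∃ M, M + K * (m * 2 ^ K) = N := ⟨N - K * (m * 2 ^ K), by omega⟩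
  have hMr : (M : ℝ) = N - K * (m * 2 ^ K : ℝ) := by
    rw [← hM]; push_cast; ring
  have hMpos : 0 < M := by
    have : (0 : ℝ) < M := by linarith
    exact_mod_cast this
  have hM1 : (1 : ℝ) ≤ M := by exact_mod_cast hMpos
  have hMN : (N : ℝ) ^ K ≤ 2 * (M : ℝ) ^ K := by
    rw [hMr]
    exact pow_le_two_mul_sub_pow hNpos (by linarith) hlen
  have hmN : 4 * (N : ℝ) ≤ 2 ^ K * (m : ℝ) ^ 2 := by
    have hN' : (N : ℝ) = Real.exp (ε * L) ^ 2 * Real.exp ((1 - 2 * ε) * L) := by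
      rw [← hNexp, ← Real.exp_nat_mul, ← Real.exp_add]
      congr 1
      push_cast
      ring
    calc 4 * (N : ℝ) ≤ (9 / 2) * N := by linarith
      _ = (3 * Real.exp (ε * L)) ^ 2 * Real.exp ((1 - 2 * ε) * L) / 2 := by rw [hN']; ring
      _ ≤ (m : ℝ) ^ 2 * (2 * 2 ^ K) / 2 := by gcongr
      _ = _ := by ring
  obtain ⟨v, hv, hvτ⟩ :=
    exists_signedSums_stage hmpos hMpos hM hMN hmN (hn₀ M (by omega)) K le_rfl
  rw [add_right_comm, hM] at hv
  refine ⟨v, hv, hvτ.trans_lt ?_⟩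
  have hmexp : (m : ℝ) ≤ Real.exp (Real.log 4 + ε * L) := by
    rw [Real.exp_add, Real.exp_log (by norm_num)]; exact hm2
  have hKexp : (K : ℝ) ≤ Real.exp (Real.log (2 * L)) := by
    rw [Real.exp_log (by linarith)]; exact hK4
  have hNK : (N : ℝ) ^ K = Real.exp (K * L) := by rw [Real.exp_nat_mul, hNexp]
  have hMK : Real.exp (K * L - Real.log 2) ≤ (M : ℝ) ^ (K + 1) := by
    rw [Real.exp_sub, Real.exp_log two_pos, ← hNK, div_le_iff₀ two_pos, pow_succ]
    nlinarith [pow_pos (zero_lt_one.trans_le hM1) K]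
  calc stepProd m K * K.factorial / (M : ℝ) ^ (K + 1)
      ≤ Real.exp (K * (Real.log 4 + ε * L) + (K : ℝ) ^ 2 / 2 * Real.log 2)
          * Real.exp (K * Real.log (2 * L)) / Real.exp (K * L - Real.log 2) := by
        have := stepProd_nonneg m K
        gcongr
        · exact stepProd_le_exp hmexp K
        · exact factorial_le_exp hKexp
    _ = Real.exp (K * (Real.log 4 + ε * L) + (K : ℝ) ^ 2 / 2 * Real.log 2
          + K * Real.log (2 * L) - (K * L - Real.log 2)) := by
        rw [← Real.exp_add, ← Real.exp_sub]
    _ < _ := by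
      exact Real.exp_lt_exp.2 (exponent_lt K.cast_nonneg hε hε' (by linarith) hC hK1 hK3 hlog hone)

theorem theorem1 (τ C : ℝ) (hC₀ : 0 < C) (hC : C < 1 / Real.log 4) :
    ∃ N₀ : ℕ, ∀ N : ℕ, N₀ ≤ N →
      minSignedHarmonicDist N τ < Real.exp (-C * (Real.log (N : ℝ)) ^ 2) := by
  obtain ⟨n₀, hn₀⟩ := eventually_exists_signedSums_le τ
  have hl4 : 0 < Real.log 4 := Real.log_pos (by norm_num)
  obtain ⟨ε, hε, hε', hCε⟩ : ∃ ε : ℝ, 0 < ε ∧ ε ≤ 1 / 8 ∧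
      C + ε < (1 - 4 * ε) / Real.log 4 := by
    rw [lt_div_iff₀ hl4] at hC
    have hpos : 0 < (1 - C * Real.log 4) / (2 * (4 + Real.log 4)) :=
      div_pos (by linarith) (by linarith)
    refine ⟨min (1 / 8) ((1 - C * Real.log 4) / (2 * (4 + Real.log 4))),
      lt_min (by norm_num) hpos, min_le_left _ _, ?_⟩
    have h := min_le_right (1 / 8 : ℝ) ((1 - C * Real.log 4) / (2 * (4 + Real.log 4)))
    rw [lt_div_iff₀ hl4]
    rw [le_div_iff₀ (by linarith)] at h
    nlinarith
  have hLtop : Filter.Tendsto (fun N : ℕ => Real.log N) Filter.atTop Filter.atTop :=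
    Real.tendsto_log_atTop.comp tendsto_natCast_atTop_atTop
  have hsq : ∀ᶠ L : ℝ in Filter.atTop, 32 * L ^ 2 ≤ Real.exp (ε * L) := by
    have h := (isLittleO_pow_exp_pos_mul_atTop 2 hε).bound (show (0 : ℝ) < 1 / 32 by norm_num)
    filter_upwards [h] with L hL
    rw [Real.norm_of_nonneg (sq_nonneg L), Real.norm_of_nonneg (Real.exp_pos _).le] at hL
    linarith
  have hlog : ∀ᶠ L : ℝ in Filter.atTop, Real.log (2 * L) + Real.log 4 ≤ ε * L / 2 := by
    have h := Real.isLittleO_log_id_atTop.bound (show (0 : ℝ) < ε / 4 by positivity)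
    filter_upwards [h, Filter.eventually_ge_atTop (1 : ℝ),
      Filter.eventually_ge_atTop (4 * (Real.log 2 + Real.log 4) / ε)] with L hL hL1 hL2
    rw [id, Real.norm_of_nonneg (Real.log_nonneg hL1), Real.norm_of_nonneg (by linarith)] at hL
    rw [div_le_iff₀ hε] at hL2
    rw [Real.log_mul two_ne_zero (by linarith)]
    linarith
  have hone : ∀ᶠ L : ℝ in Filter.atTop, Real.log 2 ≤ ε * L :=
    (Filter.tendsto_id.const_mul_atTop hε).eventually_ge_atTop _
  obtain ⟨N₀, hN₀⟩ := Filter.eventually_atTop.1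
    ((Filter.eventually_ge_atTop (2 * n₀)).and (hLtop.eventually
      ((Filter.eventually_ge_atTop 2).and (hsq.and (hlog.and hone)))))
  refine ⟨N₀, fun N hN => ?_⟩
  obtain ⟨h1, h2, h3, h4, h5⟩ := hN₀ N hN
  obtain ⟨v, hv, hvτ⟩ := exists_signedSums_lt hε hε' hCε hn₀ h1 h2 h3 h4 h5
  refine ((isLeast_minSignedHarmonicDist N τ).2 ⟨v, ?_, rfl⟩).trans_lt ?_
  · rwa [show Finset.Ico 1 (N + 1) = Finset.Icc 1 N by ext; simp] at hv
  · show |v - τ| < _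
    rwa [abs_sub_comm]
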